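/- Let $\mathbb{K}\subset\mathbb{C}$ be a unital subring and let $R$ be a finite based $\mathbb{R}_{\geq 0}$-algebra, that is, a unital associative $\mathbb{K}$-algebra with a finite $\mathbb{K}$-basis $C=\{1=c_0,\dots,c_{r-1}\}$ such that $c_ic_j=\sum_k m_{i,j}^k\, c_k$ with all $m_{i,j}^k\in\mathbb{R}_{\geq 0}$. Let $c=\sum_i a_i c_i$ with $a_i\in\mathbb{R}_{\geq 0}$ (scalars being extended to $\mathbb{C}$ if the $a_i$ are not in $\mathbb{K}$), and let $b_n=b_n^{R,c}\in\mathbb{R}_{\geq 0}$ be the sum of the coefficients of $c^n$ with respect to $C$. Let $M'(c)_{k,j}=\sum_i a_i m_{i,j}^k$, and let the action matrix $M=M(c)$ be the submatrix of $M'(c)$ whose rows and columns are indexed by the connected component, in the nonoriented sense, of $c_0=1$ in the graph on $C$ with an edge between $c_k$ and $c_j$ whenever $M'(c)_{k,j}\neq 0$. Let $\lambda=\mathrm{PFdim}\,c\in\mathbb{R}_{\geq 0}$ be the Perron--Frobenius eigenvalue of $M$, i.e. its nonnegative real eigenvalue with $\lambda\geq|\mu|$ for all complex eigenvalues $\mu$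 of $M$. Assume that $M$ has the Perron--Frobenius property: $\lambda$ has algebraic multiplicity one as an eigenvalue of $M$. Then there is a unique integer $h\geq 1$ (the period) such that, with $\zeta=\exp(2\pi i/h)$, the numbers $\zeta^k\lambda$, $0\leq k<h$, are pairwise distinct and are precisely the eigenvalues of $M$ of absolute value $\lambda$. For $0\leq k<h$ there are a right eigenvector $v_k$ and a left eigenvector $w_k$ of $M$ over $\mathbb{C}$, so $Mv_k=\zeta^k\lambda\, v_k$ and $w_k^TM=\zeta^k\lambda\, w_k^T$, with $w_k^Tv_k=1$. For every such choice put \[ a(n)=\Big(\sum_{k=0}^{h-1} v_kw_k^T[1]\cdot(\zeta^k)^n\Big)\cdot\lambda^n , \] where $v_kw_k^T[1]$ is the sum of the entries of the column of the matrix $v_kw_k^T$ indexed by $c_0=1$. Let $\lambda^{sec}$ be an eigenvalue of $M$ of largest absolute value among the eigenvalues $\mu$ with $|\mu|<\lambda$ (and $\lambda^{sec}=0$ if there are none), and let $\beta=|\lambda^{sec}|/\lambda$ (and $\beta=0$ if $\lambda=0$, which happens only for $c=0$). Then \[ b_n\sim a(n)\qquad(n\to\infty), \] and the convergence is geometric with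 ratio $\beta\in[0,1)$: for every $\gamma\in(\beta,1)$ the sequences $\big(b_n/a(n)-1\big)/\gamma^n$ and $\big((b_n-a(n))/\lambda^n\big)/\gamma^n$, $n\geq 0$, are bounded if $c\neq 0$ (for $c=0$ the relation $b_n\sim a(n)$ means that $b_n=a(n)$ for all large $n$). In particular, \[ \lim_{n\to\infty}\sqrt[n]{b_n}=\lambda=\mathrm{PFdim}\,c . \] -/

import Mathlib

open scoped ComplexOrder TensorProduct

noncomputable section

namespace BasedAlgebra

/-- A finite based `ℝ≥0`-algebra: an associative unital algebra `R` over a subring `K` of `ℂ`,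
with a finite `K`-basis that contains `1` and has structure constants in `ℝ≥0`
(for `z : ℂ`, `0 ≤ z` says that `z` is real and nonnegative). -/
structure FiniteBasedAlgebra (K : Subring ℂ) (R : Type*) [Ring R] [Algebra K R]
    (ι : Type*) [Fintype ι] where
  /-- The basis `C`. -/
  basis : Module.Basis ι K R
  /-- The index of the basis element `1`. -/
  one : ι
  basis_one : basis one = 1
  structure_nonneg : ∀ i j k : ι, 0 ≤ ((basis.repr (basis i * basis j) k : K) : ℂ)

/-- Convergence of `f` to `a`, geometrically with ratio `β ∈ [0, 1)`. -/
def ConvergesGeometrically (f : ℕ → ℂ) (a : ℂ) (β : ℝ) : Prop :=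
  0 ≤ β ∧ β < 1 ∧
    ∀ γ : ℝ, β < γ → γ < 1 → ∃ B : ℝ, ∀ n : ℕ, ‖(f n - a) / (γ : ℂ) ^ n‖ ≤ B

section Matrices

variable {m : Type*} [Fintype m] [DecidableEq m]

/-- The set of complex eigenvalues of a real square matrix. -/
def eigenvalues (M : Matrix m m ℝ) : Set ℂ :=
  spectrum ℂ (M.map Complex.ofReal)

/-- The largest absolute value of a complex eigenvalue. A nonnegative real eigenvalue that
dominates all eigenvalues in absolute value is necessarily this number. -/
def pfEigenvalue (M : Matrix m m ℝ) : ℝ :=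
  (spectralRadius ℂ (M.map Complex.ofReal)).toReal

/-- The Perron--Frobenius eigenvalue is an eigenvalue of (algebraic) multiplicity one. -/
def HasPerronFrobeniusProperty (M : Matrix m m ℝ) : Prop :=
  M.charpoly.rootMultiplicity (pfEigenvalue M) = 1

/-- The absolute value of a second largest eigenvalue, i.e. the largest absolute value of an
eigenvalue that is not of maximal absolute value. It is `0` if there is no such eigenvalue. -/
def secondModulus (M : Matrix m m ℝ) : ℝ :=
  sSup ((fun μ : ℂ => ‖μ‖) '' {μ ∈ eigenvalues M | ‖μ‖ < pfEigenvalue M})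

/-- `exp (2 π i / h)`. -/
def zeta (h : ℕ) : ℂ := Complex.exp (2 * Real.pi * Complex.I / h)

/-- `h ≥ 1` is the period: the `h` numbers `ζ ^ k * lam`, `0 ≤ k < h`, are pairwise distinct and
are precisely the eigenvalues of absolute value `lam`, where `lam` is the Perron--Frobenius
eigenvalue and `ζ = exp (2 π i / h)`. -/
def IsPeriod (M : Matrix m m ℝ) (h : ℕ) : Prop :=
  1 ≤ h ∧ Set.BijOn (fun k : ℕ => zeta h ^ k * (pfEigenvalue M : ℂ)) (Set.Iio h)
    {μ ∈ eigenvalues M | ‖μ‖ = pfEigenvalue M}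

/-- `v k` and `w k` are right and left eigenvectors for the eigenvalue `ζ ^ k * lam`, normalized
by `(w k)ᵀ (v k) = 1`. -/
def IsNormalizedEigensystem (M : Matrix m m ℝ) {h : ℕ} (v w : Fin h → m → ℂ) : Prop :=
  ∀ k : Fin h,
    (M.map Complex.ofReal).mulVec (v k) = (zeta h ^ (k : ℕ) * (pfEigenvalue M : ℂ)) • v k ∧
    Matrix.vecMul (w k) (M.map Complex.ofReal) =
      (zeta h ^ (k : ℕ) * (pfEigenvalue M : ℂ)) • w k ∧
    w k ⬝ᵥ v k = 1

/-- The sum of the entries of the column with index `j`. -/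
def columnSum (A : Matrix m m ℂ) (j : m) : ℂ := ∑ i, A i j

/-- The sequence `a(n) = (∑_{k < h} (v_k w_kᵀ)[j] (ζ ^ k) ^ n) lam ^ n`, where `[j]` is the sum
of the entries in column `j`. -/
def asymptoticFormula (M : Matrix m m ℝ) (j : m) {h : ℕ} (v w : Fin h → m → ℂ) (n : ℕ) : ℂ :=
  (∑ k : Fin h, columnSum (Matrix.vecMulVec (v k) (w k)) j * (zeta h ^ (k : ℕ)) ^ n) *
    (pfEigenvalue M : ℂ) ^ n

end Matrices

namespace FiniteBasedAlgebra

variable {K : Subring ℂ} {R : Type*} [Ring R] [Algebra K R] {ι : Type*} [Fintype ι]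
  (C : FiniteBasedAlgebra K R ι)

/-- The structure constant `m_{i,j}^k`, a nonnegative real number. -/
def structureConst (i j k : ι) : ℝ := ((C.basis.repr (C.basis i * C.basis j) k : K) : ℂ).re

/-- The element `∑ i, x i • c_i`. The real numbers `x i` need not lie in `K`, so scalars are
extended to `ℂ`. -/
def element (x : ι → ℝ) : ℂ ⊗[K] R := ∑ i, (x i : ℂ) ⊗ₜ[K] C.basis i

/-- `b_n`: the sum of the coefficients of `c ^ n` in the basis, for `c = ∑ i, x i • c_i`.
(For `x ≥ 0` all these coefficients are nonnegative real numbers.) -/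
def growth (x : ι → ℝ) (n : ℕ) : ℝ :=
  ∑ k, ((C.basis.baseChange ℂ).repr (C.element x ^ n) k).re

/-- The pre-action matrix `M'(c)_{k,j} = ∑ i, x i m_{i,j}^k`. -/
def preActionMatrix (x : ι → ℝ) : Matrix ι ι ℝ :=
  Matrix.of fun k j => ∑ i, x i * C.structureConst i j k

open Classical in
/-- The connected component, in the nonoriented sense, of `1` in the adjacency graph of the
pre-action matrix. -/
def component (x : ι → ℝ) : Finset ι :=
  {i | Relation.EqvGen (fun k j => C.preActionMatrix x k j ≠ 0) C.one i}

/-- The index of `1`, as a vertex of its connected component. -/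
def oneVertex (x : ι → ℝ) : C.component x :=
  ⟨C.one, by simpa [component] using Relation.EqvGen.refl C.one⟩

/-- The action matrix `M(c)`: the part of the pre-action matrix on the component of `1`. -/
def actionMatrix (x : ι → ℝ) : Matrix (C.component x) (C.component x) ℝ :=
  (C.preActionMatrix x).submatrix Subtype.val Subtype.val

end FiniteBasedAlgebra

end BasedAlgebra

end

/-!
Write `M` for the action matrix and `λ` for its Perron--Frobenius eigenvalue. If `λ > 0`, the
algebraic multiplicity of `ω λ`, for `|ω| = 1`, is the Cesàro mean of `ω⁻ⁿ tr (M ^ n) / λ ^ n`, and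
`tr (M ^ n) ≥ 0`. Hence it is at most the multiplicity of `λ`. In the case of equality, `ω⁻ⁿ` is
close to `1` for most `n`, in the mean weighted by `tr (M ^ n) / λ ^ n`, so all multiplicities on
the circle of radius `λ` are invariant under rotation by `ω`. As `λ` is simple, every eigenvalue of
absolute value `λ` is simple, and the quotients by `λ` form a finite subgroup of the unit circle,
that is, the `h`-th roots of unity for some `h`.

Removing these `h` simple eigenvalues by Wielandt deflation leaves a matrix of spectral radius
`|λ^sec|`. This gives `b_n - a(n) = O(ρ ^ n)` for all `ρ > |λ^sec|`.

For the relative error one needs `λ ^ n = O(b_n)`. The matrix `M ^ n` describes multiplication by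
`c ^ n`, so its entries are bounded by a constant times the sum `b_n` of the coefficients of
`c ^ n`, and `λ ^ n ≤ ‖M ^ n‖`.
-/

namespace BasedAlgebra

open Matrix Polynomial Filter Topology Asymptotics

section CesaroMeans

variable {E : Type*} [NormedAddCommGroup E] [NormedSpace ℝ E]

/-- The arithmetic means `(g 0 + ⋯ + g (N - 1)) / N` converge to `c`. -/
def HasCesaroMean (g : ℕ → E) (c : E) : Prop :=
  Tendsto (fun N : ℕ => (N : ℝ)⁻¹ • ∑ n ∈ Finset.range N, g n) atTop (𝓝 c)

theorem HasCesaroMean.unique {g : ℕ → E} {a b : E} (ha : HasCesaroMean g a)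
    (hb : HasCesaroMean g b) : a = b :=
  tendsto_nhds_unique ha hb

theorem HasCesaroMean.add {f g : ℕ → E} {a b : E} (hf : HasCesaroMean f a)
    (hg : HasCesaroMean g b) : HasCesaroMean (fun n => f n + g n) (a + b) := by
  refine (Tendsto.add hf hg).congr fun N => ?_
  rw [Finset.sum_add_distrib, smul_add]

theorem HasCesaroMean.clm_apply {F : Type*} [NormedAddCommGroup F] [NormedSpace ℝ F] {g : ℕ → E}
    {a : E} (hg : HasCesaroMean g a) (L : E →L[ℝ] F) : HasCesaroMean (fun n => L (g n)) (L a) := by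
  refine ((L.continuous.tendsto a).comp hg).congr fun N => ?_
  rw [Function.comp_apply, map_smul, map_sum]

theorem HasCesaroMean.sum {ι : Type*} {s : Finset ι} {g : ι → ℕ → E} {a : ι → E}
    (hg : ∀ i ∈ s, HasCesaroMean (g i) (a i)) :
    HasCesaroMean (fun n => ∑ i ∈ s, g i n) (∑ i ∈ s, a i) := by
  refine (tendsto_finsetSum s hg).congr fun N => ?_
  rw [Finset.sum_comm, Finset.smul_sum]

theorem HasCesaroMean.norm_le {f : ℕ → E} {g : ℕ → ℝ} {a : E} {b : ℝ} (hf : HasCesaroMean f a)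
    (hg : HasCesaroMean g b) (hfg : ∀ n, ‖f n‖ ≤ g n) : ‖a‖ ≤ b := by
  refine le_of_tendsto_of_tendsto' hf.norm hg fun N => ?_
  rw [norm_smul, norm_inv, Real.norm_natCast, smul_eq_mul]
  gcongr
  exact norm_sum_le_of_le _ fun n _ => hfg n

theorem hasCesaroMean_pow {z : ℂ} (hz : ‖z‖ ≤ 1) :
    HasCesaroMean (fun n => z ^ n) (if z = 1 then 1 else 0) := by
  split_ifs with h
  · refine tendsto_const_nhds.congr' ?_
    filter_upwards [eventually_ne_atTop 0] with N hN
    simp [h, hN]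
  · have hbdd : ∀ N : ℕ, ‖∑ n ∈ Finset.range N, z ^ n‖ ≤ 2 / ‖z - 1‖ := fun N => by
      rw [geom_sum_eq h, norm_div]
      gcongr
      calc ‖z ^ N - 1‖ ≤ ‖z ^ N‖ + ‖(1 : ℂ)‖ := norm_sub_le _ _
        _ ≤ 1 + 1 := by rw [norm_pow, norm_one]; gcongr; exact pow_le_one₀ (norm_nonneg z) hz
        _ = 2 := one_add_one_eq_two
    exact tendsto_inv_atTop_nhds_zero_nat.zero_smul_isBoundedUnder_le (isBoundedUnder_of ⟨_, hbdd⟩)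

theorem norm_sub_one_sq {z : ℂ} (hz : ‖z‖ = 1) : ‖z - 1‖ ^ 2 = 2 - 2 * z.re := by
  have h : z.re ^ 2 + z.im ^ 2 = 1 := by
    rw [← one_pow 2, ← hz, Complex.sq_norm, Complex.normSq_apply]; ring
  rw [Complex.sq_norm, Complex.normSq_apply, Complex.sub_re, Complex.sub_im, Complex.one_re,
    Complex.one_im]
  linarith

theorem HasCesaroMean.smul_of_mul_norm_sq {g : ℕ → ℝ} {s : ℕ → E} {a : ℝ} (hg : ∀ n, 0 ≤ g n)
    (hga : HasCesaroMean g a) (hgs : HasCesaroMean (fun n => g n * ‖s n‖ ^ 2) 0) :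
    HasCesaroMean (fun n => g n • s n) 0 := by
  rw [HasCesaroMean, tendsto_zero_iff_norm_tendsto_zero]
  have hprod := Real.continuous_sqrt.tendsto _ |>.comp (Tendsto.mul hga hgs)
  rw [mul_zero, Real.sqrt_zero] at hprod
  refine squeeze_zero (fun _ => norm_nonneg _) (fun N => Real.le_sqrt_of_sq_le ?_) hprod
  have hcs : (∑ n ∈ Finset.range N, g n * ‖s n‖) ^ 2 ≤
      (∑ n ∈ Finset.range N, g n) * ∑ n ∈ Finset.range N, g n * ‖s n‖ ^ 2 :=
    Finset.sum_sq_le_sum_mul_sum_of_sq_le_mul _ (fun n _ => hg n)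
      (fun n _ => mul_nonneg (hg n) (sq_nonneg _)) fun n _ => by rw [mul_pow, sq, mul_assoc]
  have hnorm : ‖∑ n ∈ Finset.range N, g n • s n‖ ≤ ∑ n ∈ Finset.range N, g n * ‖s n‖ :=
    norm_sum_le_of_le _ fun n _ => by rw [norm_smul, Real.norm_of_nonneg (hg n)]
  simp only [norm_smul, norm_inv, Real.norm_natCast, smul_eq_mul]
  calc _ ≤ ((N : ℝ)⁻¹ * ∑ n ∈ Finset.range N, g n * ‖s n‖) ^ 2 := by gcongr
    _ = (N : ℝ)⁻¹ ^ 2 * (∑ n ∈ Finset.range N, g n * ‖s n‖) ^ 2 := mul_pow ..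
    _ ≤ (N : ℝ)⁻¹ ^ 2 * ((∑ n ∈ Finset.range N, g n) *
        ∑ n ∈ Finset.range N, g n * ‖s n‖ ^ 2) := by gcongr
    _ = _ := by ring

/-- Since `|u n - 1| ^ 2 = 2 - 2 Re (u n)` has `g`-weighted mean zero, so has `u n - 1`, by the
Cauchy--Schwarz inequality. -/
theorem hasCesaroMean_mul_mul {g : ℕ → ℝ} {u v : ℕ → ℂ} {a : ℝ} {c : ℂ}
    (hg : ∀ n, 0 ≤ g n) (hu : ∀ n, ‖u n‖ = 1) (hv : ∀ n, ‖v n‖ = 1) (hga : HasCesaroMean g a)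
    (hgu : HasCesaroMean (fun n => g n * u n) (a : ℂ))
    (hgv : HasCesaroMean (fun n => g n * v n) c) :
    HasCesaroMean (fun n => g n * (u n * v n)) c := by
  have hsq : HasCesaroMean (fun n => g n * ‖(u n - 1) * v n‖ ^ 2) 0 := by
    convert (hga.clm_apply ((2 : ℝ) • .id ℝ ℝ)).add
      (hgu.clm_apply ((-2 : ℝ) • Complex.reCLM)) using 1
    · ext n
      rw [norm_mul, hv, mul_one, norm_sub_one_sq (hu n), _root_.smul_apply,
        _root_.smul_apply, ContinuousLinearMap.id_apply, Complex.reCLM_apply,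
        Complex.re_ofReal_mul, smul_eq_mul, smul_eq_mul]
      ring
    · simp
  convert (hga.smul_of_mul_norm_sq hg hsq).add hgv using 1
  · ext n
    rw [Complex.real_smul]
    ring
  · rw [zero_add]

end CesaroMeans

section TracePow

theorem trace_pow_of_isNilpotent_sub {K V : Type*} [Field K] [AddCommGroup V] [Module K V]
    [Module.Finite K V] {f : Module.End K V} {μ : K} (hf : IsNilpotent (f - algebraMap K _ μ))
    (n : ℕ) :
    LinearMap.trace K V (f ^ n) = Module.finrank K V • μ ^ n := by
  induction n with
  | zero => rw [pow_zero, pow_zero, LinearMap.trace_one, nsmul_one]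
  | succ n ih =>
    rw [pow_succ, Module.End.mul_eq_comp,
      LinearMap.trace_comp_eq_mul_of_commute_of_isNilpotent μ (Commute.pow_self f n) hf, ih,
      mul_smul_comm, pow_succ']

theorem trace_pow_eq_sum_roots_charpoly {K m : Type*} [Field K] [IsAlgClosed K] [Fintype m]
    [DecidableEq m] (A : Matrix m m K) (n : ℕ) :
    (A ^ n).trace = (A.charpoly.roots.map (· ^ n)).sum := by
  classical
  set f : Module.End K (m → K) := Matrix.toLin' A with hf
  have hcharpoly : f.charpoly = A.charpoly := Matrix.charpoly_toLin' A
  have hint := DirectSum.isInternal_submodule_of_iSupIndep_of_iSup_eq_top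
    f.independent_maxGenEigenspace f.iSup_maxGenEigenspace_eq_top
  have hfin : {μ | f.maxGenEigenspace μ ≠ ⊥}.Finite :=
    WellFoundedGT.finite_ne_bot_of_iSupIndep f.independent_maxGenEigenspace
  have hroots : A.charpoly.roots.toFinset = hfin.toFinset := by
    ext μ
    rw [Multiset.mem_toFinset, ← Multiset.count_pos, count_roots, ← hcharpoly,
      ← f.finrank_maxGenEigenspace_eq, hfin.mem_toFinset, Set.mem_ofPred_eq,
      Nat.pos_iff_ne_zero, Ne, Submodule.finrank_eq_zero]
  have hmaps (μ : K) := f.mapsTo_maxGenEigenspace_of_comm (Commute.refl f) μ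
  have hmaps_pow (μ : K) := f.mapsTo_maxGenEigenspace_of_comm (Commute.self_pow f n) μ
  have hnil (μ : K) : IsNilpotent (f.restrict (hmaps μ) - algebraMap K _ μ) :=
    f.isNilpotent_restrict_maxGenEigenspace_sub_algebraMap μ
  rw [← Matrix.trace_toLin'_eq, Matrix.toLin'_pow, ← hf, Finset.sum_multiset_map_count, hroots,
    LinearMap.trace_eq_sum_trace_restrict' hint hfin hmaps_pow]
  refine Finset.sum_congr rfl fun μ _ => ?_
  rw [← Module.End.pow_restrict n (hmaps μ), trace_pow_of_isNilpotent_sub (hnil μ),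
    f.finrank_maxGenEigenspace_eq, hcharpoly, count_roots]

end TracePow

section PowerGrowth

theorem isBigO_pow_of_spectralRadius_lt {𝔸 : Type*} [NormedRing 𝔸] [NormedAlgebra ℂ 𝔸]
    [CompleteSpace 𝔸] {a : 𝔸} {ρ : ℝ} (ha : spectralRadius ℂ a < ENNReal.ofReal ρ) :
    (fun n : ℕ => a ^ n) =O[atTop] fun n => ρ ^ n := by
  have hρ : 0 < ρ := ENNReal.ofReal_pos.1 (pos_of_gt ha)
  have h := (spectrum.pow_norm_pow_one_div_tendsto_nhds_spectralRadius a).eventually_lt_const ha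
  refine IsBigO.of_bound' ?_
  filter_upwards [h, eventually_ne_atTop 0] with n hn hn0
  have hroot : ‖a ^ n‖ ^ (1 / n : ℝ) < ρ := (ENNReal.ofReal_lt_ofReal_iff hρ).1 hn
  calc ‖a ^ n‖ = (‖a ^ n‖ ^ (1 / n : ℝ)) ^ n := by
        rw [one_div, Real.rpow_inv_natCast_pow (norm_nonneg _) hn0]
    _ ≤ ρ ^ n := by gcongr
    _ ≤ ‖ρ ^ n‖ := le_abs_self _

theorem spectralRadius_pow_le_norm_pow {𝔸 : Type*} [NormedRing 𝔸] [NormedAlgebra ℂ 𝔸]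
    [CompleteSpace 𝔸] [NormOneClass 𝔸] (a : 𝔸) (n : ℕ) :
    (spectralRadius ℂ a).toReal ^ n ≤ ‖a ^ n‖ := by
  have : Nontrivial 𝔸 := NormOneClass.nontrivial
  have h : spectralRadius ℂ a ^ n ≤ ‖a ^ n‖₊ :=
    (spectrum.spectralRadius_pow_le' a n).trans (spectrum.spectralRadius_le_nnnorm _)
  rw [← ENNReal.toReal_pow]
  exact ENNReal.toReal_mono ENNReal.coe_ne_top h

end PowerGrowth

section Trace

variable {m : Type*} [Fintype m] [DecidableEq m]

theorem hasCesaroMean_trace_pow_div (A : Matrix m m ℂ) {z : ℂ} (hz : z ≠ 0)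
    (hA : ∀ μ ∈ spectrum ℂ A, ‖μ‖ ≤ ‖z‖) :
    HasCesaroMean (fun n => (A ^ n).trace / z ^ n) (A.charpoly.rootMultiplicity z : ℂ) := by
  have hmean : ∀ μ ∈ A.charpoly.roots.toFinset,
      HasCesaroMean (fun n => (A.charpoly.rootMultiplicity μ : ℂ) * (μ / z) ^ n)
        (A.charpoly.rootMultiplicity μ * if μ = z then 1 else 0) := fun μ hμ => by
    have hroot := isRoot_of_mem_roots (Multiset.mem_toFinset.1 hμ)
    have hle : ‖μ / z‖ ≤ 1 := by
      rw [norm_div]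
      exact div_le_one_of_le₀ (hA μ (mem_spectrum_of_isRoot_charpoly hroot)) (norm_nonneg z)
    simpa only [div_eq_one_iff_eq hz, ContinuousLinearMap.mul_apply'] using
      (hasCesaroMean_pow hle).clm_apply (.mul ℝ ℂ (rootMultiplicity μ A.charpoly))
  convert HasCesaroMean.sum hmean using 1
  · ext n
    rw [trace_pow_eq_sum_roots_charpoly, Finset.sum_multiset_map_count, Finset.sum_div]
    simp only [count_roots, nsmul_eq_mul, div_pow, mul_div_assoc]
  · simp only [mul_ite, mul_one, mul_zero, Finset.sum_ite_eq', Multiset.mem_toFinset, mem_roots',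
      left_eq_ite_iff, not_and]
    intro h
    rw [Nat.cast_eq_zero, rootMultiplicity_eq_zero (h A.charpoly_monic.ne_zero)]

end Trace

section Spectrum

variable {m : Type*} [Fintype m] [DecidableEq m] {M : Matrix m m ℝ}

theorem pfEigenvalue_nonneg (M : Matrix m m ℝ) : 0 ≤ pfEigenvalue M := ENNReal.toReal_nonneg

theorem norm_pfEigenvalue (M : Matrix m m ℝ) : ‖(pfEigenvalue M : ℂ)‖ = pfEigenvalue M :=
  Complex.norm_of_nonneg (pfEigenvalue_nonneg M)

theorem finite_eigenvalues (M : Matrix m m ℝ) : (eigenvalues M).Finite :=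
  Matrix.finite_spectrum _

theorem mem_eigenvalues_iff_rootMultiplicity_ne_zero {z : ℂ} :
    z ∈ eigenvalues M ↔ (M.map Complex.ofReal).charpoly.rootMultiplicity z ≠ 0 := by
  rw [← Nat.pos_iff_ne_zero, rootMultiplicity_pos (charpoly_monic _).ne_zero]
  exact mem_spectrum_iff_isRoot_charpoly

theorem norm_le_pfEigenvalue {z : ℂ} (hz : z ∈ eigenvalues M) : ‖z‖ ≤ pfEigenvalue M := by
  open scoped Matrix.Norms.Operator in
  have hle : (‖z‖₊ : ENNReal) ≤ spectralRadius ℂ (M.map Complex.ofReal) :=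
    le_iSup₂ (f := fun (k : ℂ) (_ : k ∈ eigenvalues M) => (‖k‖₊ : ENNReal)) z hz
  open scoped Matrix.Norms.Operator in
  have htop : spectralRadius ℂ (M.map Complex.ofReal) ≠ ⊤ := by
    obtain ⟨y, -, hy⟩ := spectrum.exists_nnnorm_eq_spectralRadius_of_nonempty ⟨z, hz⟩
    exact hy ▸ ENNReal.coe_ne_top
  exact ENNReal.toReal_mono htop hle

theorem HasPerronFrobeniusProperty.rootMultiplicity_map_ofReal
    (hPF : HasPerronFrobeniusProperty M) :
    (M.map Complex.ofReal).charpoly.rootMultiplicity (pfEigenvalue M : ℂ) = 1 := by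
  change (M.map Complex.ofRealHom).charpoly.rootMultiplicity (Complex.ofRealHom _) = 1
  rw [charpoly_map, ← eq_rootMultiplicity_map Complex.ofReal_injective]
  exact hPF

end Spectrum

section PeripheralSpectrum

variable {m : Type*} [Fintype m] [DecidableEq m] {M : Matrix m m ℝ}

/-- The algebraic multiplicity of `ω * λ` as an eigenvalue of `M`, for `ω` on the unit circle and
`λ` the Perron--Frobenius eigenvalue. -/
noncomputable def peripheralMultiplicity (M : Matrix m m ℝ) (ω : Circle) : ℕ :=
  (M.map Complex.ofReal).charpoly.rootMultiplicity (ω * pfEigenvalue M : ℂ)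

theorem HasPerronFrobeniusProperty.peripheralMultiplicity_one (hPF : HasPerronFrobeniusProperty M) :
    peripheralMultiplicity M 1 = 1 := by
  rw [peripheralMultiplicity, Circle.coe_one, one_mul, hPF.rootMultiplicity_map_ofReal]

theorem mul_pfEigenvalue_mem_eigenvalues_iff {ω : Circle} :
    (ω * pfEigenvalue M : ℂ) ∈ eigenvalues M ↔ peripheralMultiplicity M ω ≠ 0 :=
  mem_eigenvalues_iff_rootMultiplicity_ne_zero

theorem trace_pow_div_pow_nonneg (hM : ∀ i j, 0 ≤ M i j) (n : ℕ) :
    0 ≤ (M ^ n).trace / pfEigenvalue M ^ n :=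
  div_nonneg (Finset.sum_nonneg fun i _ => pow_apply_nonneg hM n i i)
    (pow_nonneg (pfEigenvalue_nonneg M) n)

theorem hasCesaroMean_trace_pow_mul (hpos : 0 < pfEigenvalue M) (ω : Circle) :
    HasCesaroMean (fun n => (((M ^ n).trace / pfEigenvalue M ^ n : ℝ) : ℂ) * (ω⁻¹ : ℂ) ^ n)
      (peripheralMultiplicity M ω : ℂ) := by
  have hnorm : ‖(ω * pfEigenvalue M : ℂ)‖ = pfEigenvalue M := by
    rw [norm_mul, Circle.norm_coe, one_mul, norm_pfEigenvalue]
  have h := hasCesaroMean_trace_pow_div (M.map Complex.ofReal)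
    (norm_ne_zero_iff.1 (hnorm.trans_ne hpos.ne')) fun μ hμ =>
      (norm_le_pfEigenvalue hμ).trans_eq hnorm.symm
  rw [peripheralMultiplicity]
  convert h using 2 with n
  have htrace : ((M ^ n).trace : ℂ) = (M.map Complex.ofReal ^ n).trace := by
    change _ = (Complex.ofRealHom.mapMatrix M ^ n).trace
    rw [← map_pow]
    exact AddMonoidHom.map_trace Complex.ofRealHom _
  rw [← htrace, mul_pow, Complex.ofReal_div, Complex.ofReal_pow, inv_pow, mul_comm ((ω : ℂ) ^ n),
    ← div_div, div_eq_mul_inv _ ((ω : ℂ) ^ n)]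

theorem hasCesaroMean_trace_pow (hpos : 0 < pfEigenvalue M) :
    HasCesaroMean (fun n => (M ^ n).trace / pfEigenvalue M ^ n)
      (peripheralMultiplicity M 1 : ℝ) := by
  simpa only [Circle.coe_one, inv_one, one_pow, mul_one, Complex.reCLM_apply, Complex.ofReal_re,
    Complex.natCast_re] using (hasCesaroMean_trace_pow_mul hpos 1).clm_apply Complex.reCLM

theorem peripheralMultiplicity_le (hM : ∀ i j, 0 ≤ M i j) (hpos : 0 < pfEigenvalue M)
    (ω : Circle) : peripheralMultiplicity M ω ≤ peripheralMultiplicity M 1 := by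
  have h := (hasCesaroMean_trace_pow_mul hpos ω).norm_le (hasCesaroMean_trace_pow hpos) fun n => by
    rw [norm_mul, norm_pow, norm_inv, Circle.norm_coe, inv_one, one_pow, mul_one,
      Complex.norm_of_nonneg (trace_pow_div_pow_nonneg hM n)]
  exact_mod_cast (Complex.norm_natCast _).symm.trans_le h

theorem peripheralMultiplicity_mul (hM : ∀ i j, 0 ≤ M i j) (hpos : 0 < pfEigenvalue M)
    {ω : Circle} (hω : peripheralMultiplicity M ω = peripheralMultiplicity M 1) (η : Circle) :
    peripheralMultiplicity M (ω * η) = peripheralMultiplicity M η := by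
  have hunit (θ : Circle) (n : ℕ) : ‖(θ⁻¹ : ℂ) ^ n‖ = 1 := by
    rw [norm_pow, norm_inv, Circle.norm_coe, inv_one, one_pow]
  have hmean_ω := hasCesaroMean_trace_pow_mul hpos ω
  rw [hω, ← Complex.ofReal_natCast] at hmean_ω
  have hmean := hasCesaroMean_mul_mul (trace_pow_div_pow_nonneg hM) (hunit ω) (hunit η)
    (hasCesaroMean_trace_pow hpos) hmean_ω (hasCesaroMean_trace_pow_mul hpos η)
  have hmean' := hasCesaroMean_trace_pow_mul hpos (ω * η)
  simp only [Circle.coe_mul, mul_inv, mul_pow] at hmean'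
  exact_mod_cast hmean'.unique hmean

/-- The rotations of the peripheral spectrum: the points of the unit circle under which the
algebraic multiplicities of the eigenvalues of maximal absolute value are invariant. -/
def peripheralGroup (M : Matrix m m ℝ) : Subgroup Circle where
  carrier := {ω | ∀ η : Circle, peripheralMultiplicity M (ω * η) = peripheralMultiplicity M η}
  one_mem' η := by rw [one_mul]
  mul_mem' {ω θ} hω hθ η := by rw [mul_assoc, hω, hθ]
  inv_mem' {ω} hω η := by rw [← hω, mul_inv_cancel_left]

theorem peripheralMultiplicity_eq_one (hPF : HasPerronFrobeniusProperty M) {ω : Circle}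
    (hω : ω ∈ peripheralGroup M) : peripheralMultiplicity M ω = 1 := by
  rw [← mul_one ω, hω 1, hPF.peripheralMultiplicity_one]

theorem mem_peripheralGroup_iff (hM : ∀ i j, 0 ≤ M i j) (hPF : HasPerronFrobeniusProperty M)
    (hpos : 0 < pfEigenvalue M) {ω : Circle} :
    ω ∈ peripheralGroup M ↔ (ω * pfEigenvalue M : ℂ) ∈ eigenvalues M := by
  rw [mul_pfEigenvalue_mem_eigenvalues_iff]
  refine ⟨fun hω => ?_, fun hω => peripheralMultiplicity_mul hM hpos ?_⟩
  · exact peripheralMultiplicity_eq_one hPF hω ▸ one_ne_zero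
  · have hle := peripheralMultiplicity_le hM hpos ω
    rw [hPF.peripheralMultiplicity_one] at hle ⊢
    exact le_antisymm hle (Nat.one_le_iff_ne_zero.2 hω)

theorem exists_circle_mul_pfEigenvalue_eq {z : ℂ} (hz : ‖z‖ = pfEigenvalue M) :
    ∃ ω : Circle, (ω * pfEigenvalue M : ℂ) = z :=
  ⟨Circle.exp z.arg, by rw [Circle.coe_exp, ← hz, mul_comm, Complex.norm_mul_exp_arg_mul_I]⟩

theorem bijOn_peripheralGroup (hM : ∀ i j, 0 ≤ M i j) (hPF : HasPerronFrobeniusProperty M)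
    (hpos : 0 < pfEigenvalue M) :
    Set.BijOn (fun ω : Circle => (ω * pfEigenvalue M : ℂ)) (peripheralGroup M)
      {μ ∈ eigenvalues M | ‖μ‖ = pfEigenvalue M} := by
  refine ⟨fun ω hω => ⟨(mem_peripheralGroup_iff hM hPF hpos).1 hω, ?_⟩, fun ω _ η _ h => ?_, ?_⟩
  · rw [norm_mul, Circle.norm_coe, one_mul, norm_pfEigenvalue]
  · exact Circle.ext (mul_right_cancel₀ (Complex.ofReal_ne_zero.2 hpos.ne') h)
  · rintro z ⟨hz, hnorm⟩
    obtain ⟨ω, rfl⟩ := exists_circle_mul_pfEigenvalue_eq hnorm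
    exact ⟨ω, (mem_peripheralGroup_iff hM hPF hpos).2 hz, rfl⟩

end PeripheralSpectrum

section Period

variable {m : Type*} [Fintype m] [DecidableEq m] {M : Matrix m m ℝ}

theorem isPrimitiveRoot_zeta {h : ℕ} (hh : h ≠ 0) : IsPrimitiveRoot (zeta h) h :=
  Complex.isPrimitiveRoot_exp h hh

theorem bijOn_zeta_pow (G : Subgroup Circle) [Finite G] :
    Set.BijOn (fun k => zeta (Nat.card G) ^ k) (Set.Iio (Nat.card G))
      (Circle.coeHom '' (G : Set Circle)) := by
  have hcard : Nat.card G ≠ 0 := Nat.card_pos.ne'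
  have hζ := isPrimitiveRoot_zeta hcard
  have hinj : Set.InjOn (fun k => zeta (Nat.card G) ^ k) (Set.Iio (Nat.card G)) :=
    fun k hk l hl => hζ.pow_inj hk hl
  have hsub : Circle.coeHom '' (G : Set Circle) ⊆
      (fun k => zeta (Nat.card G) ^ k) '' Set.Iio (Nat.card G) := by
    rintro _ ⟨ω, hω, rfl⟩
    have hpow : (ω : ℂ) ^ Nat.card G = 1 :=
      congrArg (fun ω : G => ((ω : Circle) : ℂ)) (pow_card_eq_one' (x := (⟨ω, hω⟩ : G)))
    have : NeZero (Nat.card G) := ⟨hcard⟩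
    exact hζ.eq_pow_of_pow_eq_one hpow
  convert hinj.bijOn_image using 1
  refine Set.eq_of_subset_of_ncard_le hsub (le_of_eq ?_) ((Set.finite_Iio _).image _)
  rw [hinj.ncard_image, Set.ncard_Iio_nat,
    Set.ncard_image_of_injective (f := Circle.coeHom) _ Circle.coe_injective]
  rfl

theorem exists_isPeriod (hM : ∀ i j, 0 ≤ M i j) (hPF : HasPerronFrobeniusProperty M) :
    ∃ h, IsPeriod M h := by
  rcases (pfEigenvalue_nonneg M).eq_or_lt' with hzero | hpos
  · refine ⟨1, le_rfl, ?_⟩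
    have hperipheral : {μ ∈ eigenvalues M | ‖μ‖ = pfEigenvalue M} = {0} := by
      ext μ
      rw [Set.mem_ofPred_eq, hzero, norm_eq_zero, Set.mem_singleton_iff, and_iff_right_iff_imp]
      rintro rfl
      rw [mem_eigenvalues_iff_rootMultiplicity_ne_zero]
      have hmult := hPF.rootMultiplicity_map_ofReal
      rw [hzero, Complex.ofReal_zero] at hmult
      exact hmult ▸ one_ne_zero
    rw [hperipheral]
    simp [hzero]
  · have hbij := bijOn_peripheralGroup hM hPF hpos
    have hfin : (peripheralGroup M : Set Circle).Finite :=
      .of_injOn hbij.mapsTo hbij.injOn ((finite_eigenvalues M).subset fun _ h => h.1)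
    have : Finite (peripheralGroup M) := hfin
    refine ⟨Nat.card (peripheralGroup M), Nat.card_pos, ?_⟩
    have hscale : Set.BijOn (fun z : ℂ => z * pfEigenvalue M)
        (Circle.coeHom '' (peripheralGroup M : Set Circle))
        {μ ∈ eigenvalues M | ‖μ‖ = pfEigenvalue M} := by
      refine ⟨?_, fun _ _ _ _ h => mul_right_cancel₀ (Complex.ofReal_ne_zero.2 hpos.ne') h, ?_⟩
      · exact Set.mapsTo_image_iff.2 hbij.mapsTo
      · rw [Set.SurjOn, Set.image_image]
        exact hbij.surjOn
    exact hscale.comp (bijOn_zeta_pow _)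

theorem rootMultiplicity_eq_one_of_norm_eq (hM : ∀ i j, 0 ≤ M i j)
    (hPF : HasPerronFrobeniusProperty M) {z : ℂ} (hz : z ∈ eigenvalues M)
    (hnorm : ‖z‖ = pfEigenvalue M) : (M.map Complex.ofReal).charpoly.rootMultiplicity z = 1 := by
  rcases (pfEigenvalue_nonneg M).eq_or_lt' with hzero | hpos
  · rw [hzero, norm_eq_zero] at hnorm
    simpa [hzero, hnorm] using hPF.rootMultiplicity_map_ofReal
  · obtain ⟨ω, rfl⟩ := exists_circle_mul_pfEigenvalue_eq hnorm
    exact peripheralMultiplicity_eq_one hPF ((mem_peripheralGroup_iff hM hPF hpos).2 hz)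

end Period

section SimpleEigenvalue

variable {K : Type*} [Field K]

section Endomorphism

variable {V : Type*} [AddCommGroup V] [Module K V] [Module.Finite K V] {f : Module.End K V}
  {z : K} {v : V}

theorem maxGenEigenspace_eq_span_singleton (hz : f.charpoly.rootMultiplicity z = 1)
    (hv : f.HasEigenvector z v) : f.maxGenEigenspace z = K ∙ v := by
  refine (Submodule.eq_of_le_of_finrank_eq ?_ ?_).symm
  · rw [Submodule.span_singleton_le_iff_mem]
    exact Module.End.eigenspace_le_maxGenEigenspace hv.1
  · rw [finrank_span_singleton hv.2, f.finrank_maxGenEigenspace_eq, hz]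

theorem eigenvector_notMem_range_sub (hz : f.charpoly.rootMultiplicity z = 1)
    (hv : f.HasEigenvector z v) : v ∉ LinearMap.range (f - z • 1) := by
  rintro ⟨y, hy⟩
  have hfv : (f - z • 1) v = 0 := by simp [hv.apply_eq_smul]
  have hymem : y ∈ f.maxGenEigenspace z := by
    rw [Module.End.mem_maxGenEigenspace]
    exact ⟨2, by rw [pow_two, Module.End.mul_apply, hy, hfv]⟩
  rw [maxGenEigenspace_eq_span_singleton hz hv, Submodule.mem_span_singleton] at hymem
  obtain ⟨c, rfl⟩ := hymem
  rw [map_smul, hfv, smul_zero] at hy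
  exact hv.2 hy.symm

theorem exists_dual_eigenvector (hz : f.charpoly.rootMultiplicity z = 1)
    (hv : f.HasEigenvector z v) : ∃ φ : Module.Dual K V, φ ∘ₗ f = z • φ ∧ φ v = 1 := by
  obtain ⟨φ, hφv, hφ⟩ := Submodule.exists_le_ker_of_notMem (eigenvector_notMem_range_sub hz hv)
  refine ⟨(φ v)⁻¹ • φ, LinearMap.ext fun y => ?_, inv_mul_cancel₀ hφv⟩
  have hy : φ (f y - z • y) = 0 := hφ ⟨y, rfl⟩
  rw [map_sub, sub_eq_zero, map_smul] at hy
  rw [LinearMap.comp_apply, LinearMap.smul_apply, LinearMap.smul_apply, LinearMap.smul_apply, hy,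
    smul_comm]

end Endomorphism

variable {m : Type*} [Fintype m] [DecidableEq m] {A : Matrix m m K} {z : K}

theorem exists_mulVec_eq_smul (hz : z ∈ spectrum K A) : ∃ v ≠ 0, A *ᵥ v = z • v := by
  rw [← spectrum_toLin', ← Module.End.hasEigenvalue_iff_mem_spectrum] at hz
  obtain ⟨v, hv⟩ := hz.exists_hasEigenvector
  exact ⟨v, hv.2, hv.apply_eq_smul⟩

theorem mem_spectrum_of_mulVec_eq_smul {v : m → K} (hv : v ≠ 0) (hAv : A *ᵥ v = z • v) :
    z ∈ spectrum K A := by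
  rw [← spectrum_toLin', ← Module.End.hasEigenvalue_iff_mem_spectrum]
  exact Module.End.hasEigenvalue_of_hasEigenvector ⟨Module.End.mem_eigenspace_iff.2 hAv, hv⟩

theorem exists_smul_eq_of_mulVec_eq_smul (hz : A.charpoly.rootMultiplicity z = 1) {u v : m → K}
    (hv : v ≠ 0) (hAv : A *ᵥ v = z • v) (hAu : A *ᵥ u = z • u) : ∃ c : K, c • v = u := by
  rw [← charpoly_toLin'] at hz
  rw [← Submodule.mem_span_singleton, ← maxGenEigenspace_eq_span_singleton hz
    ⟨Module.End.mem_eigenspace_iff.2 hAv, hv⟩]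
  exact Module.End.eigenspace_le_maxGenEigenspace (Module.End.mem_eigenspace_iff.2 hAu)

theorem exists_normalized_eigenvectors (hz : A.charpoly.rootMultiplicity z = 1) :
    ∃ v w : m → K, A *ᵥ v = z • v ∧ w ᵥ* A = z • w ∧ w ⬝ᵥ v = 1 := by
  have hroot : A.charpoly.IsRoot z :=
    (rootMultiplicity_pos (charpoly_monic A).ne_zero).1 (hz ▸ one_pos)
  obtain ⟨v, hv, hAv⟩ := exists_mulVec_eq_smul (mem_spectrum_of_isRoot_charpoly hroot)
  rw [← charpoly_toLin'] at hz
  obtain ⟨φ, hφ, hφv⟩ := exists_dual_eigenvector hz ⟨Module.End.mem_eigenspace_iff.2 hAv, hv⟩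
  obtain ⟨w, rfl⟩ := (dotProductEquiv K m).surjective φ
  refine ⟨v, w, hAv, dotProduct_eq _ _ fun y => ?_, hφv⟩
  rw [← dotProduct_mulVec, smul_dotProduct]
  exact LinearMap.congr_fun hφ y

end SimpleEigenvalue

section Deflation

variable {m : Type*} [Fintype m] {κ : Type*} {K : Type*}

/-- The `v k` and `w k` are right and left eigenvectors of `A` for the eigenvalues `μ k`, normalized
by `w k ⬝ᵥ v k = 1`. -/
structure IsEigensystem [CommRing K] (A : Matrix m m K) (μ : κ → K) (v w : κ → m → K) :
    Prop where
  mulVec_eq (k : κ) : A *ᵥ v k = μ k • v k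
  vecMul_eq (k : κ) : w k ᵥ* A = μ k • w k
  dotProduct_self (k : κ) : w k ⬝ᵥ v k = 1

/-- Wielandt deflation: for an eigensystem of `A`, the eigenvalues `μ k` of `A` are replaced
by `0`. -/
def deflation [Fintype κ] [CommRing K] (A : Matrix m m K) (μ : κ → K) (v w : κ → m → K) :
    Matrix m m K :=
  A - ∑ k, μ k • vecMulVec (v k) (w k)

section CommRing

variable [CommRing K] {A : Matrix m m K} {μ : κ → K} {v w : κ → m → K}

theorem IsEigensystem.ne_zero [Nontrivial K] (h : IsEigensystem A μ v w) (k : κ) : v k ≠ 0 :=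
  fun hv => one_ne_zero ((h.dotProduct_self k).symm.trans (hv ▸ dotProduct_zero _))

theorem IsEigensystem.dotProduct_of_ne [IsDomain K] (h : IsEigensystem A μ v w)
    (hμ : μ.Injective) {k l : κ} (hkl : k ≠ l) : w k ⬝ᵥ v l = 0 := by
  have heq : μ k * (w k ⬝ᵥ v l) = μ l * (w k ⬝ᵥ v l) := by
    rw [← smul_eq_mul, ← smul_dotProduct, ← h.vecMul_eq, ← dotProduct_mulVec, h.mulVec_eq,
      dotProduct_smul, smul_eq_mul]
  exact (mul_eq_mul_right_iff.1 heq).resolve_left (hμ.ne hkl)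

variable [Fintype κ]

theorem IsEigensystem.vecMul_deflation [IsDomain K] (h : IsEigensystem A μ v w)
    (hμ : μ.Injective) (k : κ) : w k ᵥ* deflation A μ v w = 0 := by
  rw [deflation, vecMul_sub, vecMul_sum, h.vecMul_eq, sub_eq_zero, Finset.sum_eq_single k]
  · rw [vecMul_smul, vecMul_vecMulVec, h.dotProduct_self, one_smul]
  · intro l _ hlk
    rw [vecMul_smul, vecMul_vecMulVec, h.dotProduct_of_ne hμ hlk.symm, zero_smul, smul_zero]
  · exact fun hk => absurd (Finset.mem_univ k) hk

theorem IsEigensystem.pow_sub_sum [IsDomain K] [DecidableEq m] (h : IsEigensystem A μ v w)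
    (hμ : μ.Injective) {n : ℕ} (hn : 1 ≤ n) :
    A ^ n - ∑ k, μ k ^ n • vecMulVec (v k) (w k) = deflation A μ v w ^ n := by
  induction n, hn using Nat.le_induction with
  | base => simp only [pow_one, deflation]
  | succ n hn ih =>
    have hmul (k : κ) : A * vecMulVec (v k) (w k) = μ k • vecMulVec (v k) (w k) := by
      rw [mul_vecMulVec, h.mulVec_eq, smul_vecMulVec]
    have hzero (k : κ) : vecMulVec (v k) (w k) * deflation A μ v w ^ n = 0 := by
      rw [← Nat.sub_add_cancel hn, pow_succ', ← mul_assoc, vecMulVec_mul, h.vecMul_deflation hμ,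
        vecMulVec_zero, zero_mul]
    calc A ^ (n + 1) - ∑ k, μ k ^ (n + 1) • vecMulVec (v k) (w k)
        = A * (A ^ n - ∑ k, μ k ^ n • vecMulVec (v k) (w k)) := by
          simp only [mul_sub, Finset.mul_sum, mul_smul_comm, hmul, smul_smul, pow_succ', mul_comm]
      _ = (deflation A μ v w + ∑ k, μ k • vecMulVec (v k) (w k)) * deflation A μ v w ^ n := by
          rw [ih, deflation, sub_add_cancel]
      _ = deflation A μ v w ^ (n + 1) := by
          simp only [add_mul, Finset.sum_mul, smul_mul_assoc, hzero, smul_zero,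
            Finset.sum_const_zero, add_zero, pow_succ']

end CommRing

variable [Field K] [DecidableEq m] [Fintype κ] {A : Matrix m m K} {μ : κ → K} {v w : κ → m → K}

theorem IsEigensystem.mem_spectrum_of_mem_spectrum_deflation (h : IsEigensystem A μ v w)
    (hμ : μ.Injective) (hsimple : ∀ k, A.charpoly.rootMultiplicity (μ k) = 1) {z : K}
    (hz : z ∈ spectrum K (deflation A μ v w)) (hz0 : z ≠ 0) : z ∈ spectrum K A \ Set.range μ := by
  obtain ⟨u, hu, hNu⟩ := exists_mulVec_eq_smul hz
  have horth (k : κ) : w k ⬝ᵥ u = 0 := by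
    have : z • (w k ⬝ᵥ u) = 0 := by
      rw [← dotProduct_smul, ← hNu, dotProduct_mulVec, h.vecMul_deflation hμ, zero_dotProduct]
    exact (smul_eq_zero.1 this).resolve_left hz0
  have hAu : A *ᵥ u = z • u := by
    rw [← hNu, deflation, sub_mulVec, sum_mulVec, Finset.sum_eq_zero, sub_zero]
    intro k _
    rw [smul_mulVec, vecMulVec_mulVec, horth, MulOpposite.op_zero, zero_smul, smul_zero]
  refine ⟨mem_spectrum_of_mulVec_eq_smul hu hAu, ?_⟩
  rintro ⟨k, rfl⟩
  obtain ⟨c, rfl⟩ :=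
    exists_smul_eq_of_mulVec_eq_smul (hsimple k) (h.ne_zero k) (h.mulVec_eq k) hAu
  refine hu ?_
  rw [← mul_one c, ← h.dotProduct_self k, ← smul_eq_mul, ← dotProduct_smul, horth, zero_smul]

end Deflation

section SecondModulus

theorem isBigO_pow_apply_of_spectrum_lt {m : Type*} [Fintype m] [DecidableEq m]
    {A : Matrix m m ℂ} {ρ : ℝ} (hA : ∀ z ∈ spectrum ℂ A, ‖z‖ < ρ) (i j : m) :
    (fun n => (A ^ n) i j) =O[atTop] fun n => ρ ^ n := by
  open scoped Matrix.Norms.Operator in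
  have : Nonempty m := ⟨i⟩
  obtain ⟨z, hz⟩ := spectrum.nonempty A
  lift ρ to NNReal using (norm_nonneg z).trans (hA z hz).le
  have hrad : spectralRadius ℂ A < ENNReal.ofReal ρ := by
    rw [ENNReal.ofReal_coe_nnreal]
    exact spectrum.spectralRadius_lt_of_forall_lt A hA
  exact ((entryLinearMap ℂ ℂ i j).toContinuousLinearMap.isBigO_comp _ _).trans
    (isBigO_pow_of_spectralRadius_lt hrad)

variable {m : Type*} [Fintype m] [DecidableEq m] {M : Matrix m m ℝ}

theorem norm_zeta_pow {h : ℕ} (hh : h ≠ 0) (k : ℕ) : ‖zeta h ^ k‖ = 1 := by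
  rw [norm_pow, (isPrimitiveRoot_zeta hh).norm'_eq_one hh, one_pow]

theorem secondModulus_nonneg (M : Matrix m m ℝ) : 0 ≤ secondModulus M :=
  Real.sSup_nonneg (Set.forall_mem_image.2 fun z _ => norm_nonneg z)

theorem finite_norm_nonperipheral (M : Matrix m m ℝ) :
    ((fun μ : ℂ => ‖μ‖) '' {μ ∈ eigenvalues M | ‖μ‖ < pfEigenvalue M}).Finite :=
  ((finite_eigenvalues M).subset fun _ hz => hz.1).image _

theorem norm_le_secondModulus {z : ℂ} (hz : z ∈ eigenvalues M) (hlt : ‖z‖ < pfEigenvalue M) :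
    ‖z‖ ≤ secondModulus M :=
  le_csSup (finite_norm_nonperipheral M).bddAbove ⟨z, ⟨hz, hlt⟩, rfl⟩

theorem secondModulus_lt_pfEigenvalue (hpos : 0 < pfEigenvalue M) :
    secondModulus M < pfEigenvalue M := by
  rcases Set.eq_empty_or_nonempty
    ((fun μ : ℂ => ‖μ‖) '' {μ ∈ eigenvalues M | ‖μ‖ < pfEigenvalue M}) with hempty | hne
  · rwa [secondModulus, hempty, Real.sSup_empty]
  · obtain ⟨z, hz, hzs⟩ := hne.csSup_mem (finite_norm_nonperipheral M)
    rw [secondModulus, ← hzs]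
    exact hz.2

/-- The eigenvalue `ζ ^ k * λ`, where `ζ = exp (2 π i / h)` and `λ` is the Perron--Frobenius
eigenvalue. -/
noncomputable def peripheralEigenvalue (M : Matrix m m ℝ) (h : ℕ) (k : Fin h) : ℂ :=
  zeta h ^ (k : ℕ) * pfEigenvalue M

theorem IsPeriod.injective_peripheralEigenvalue {h : ℕ} (hh : IsPeriod M h) :
    (peripheralEigenvalue M h).Injective :=
  fun k l hkl => Fin.ext (hh.2.injOn k.2 l.2 hkl)

theorem IsPeriod.range_peripheralEigenvalue {h : ℕ} (hh : IsPeriod M h) :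
    Set.range (peripheralEigenvalue M h) = {μ ∈ eigenvalues M | ‖μ‖ = pfEigenvalue M} := by
  rw [← hh.2.image_eq]
  ext z
  simp [peripheralEigenvalue, Fin.exists_iff]

theorem IsPeriod.rootMultiplicity_peripheralEigenvalue (hM : ∀ i j, 0 ≤ M i j)
    (hPF : HasPerronFrobeniusProperty M) {h : ℕ} (hh : IsPeriod M h) (k : Fin h) :
    (M.map Complex.ofReal).charpoly.rootMultiplicity (peripheralEigenvalue M h k) = 1 :=
  have hk := hh.range_peripheralEigenvalue.subset (Set.mem_range_self k)
  rootMultiplicity_eq_one_of_norm_eq hM hPF hk.1 hk.2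

theorem IsPeriod.exists_isNormalizedEigensystem (hM : ∀ i j, 0 ≤ M i j)
    (hPF : HasPerronFrobeniusProperty M) {h : ℕ} (hh : IsPeriod M h) :
    ∃ v w : Fin h → m → ℂ, IsNormalizedEigensystem M v w := by
  choose v w hvw using fun k : Fin h =>
    exists_normalized_eigenvectors (hh.rootMultiplicity_peripheralEigenvalue hM hPF k)
  exact ⟨v, w, hvw⟩

variable {h : ℕ} {v w : Fin h → m → ℂ}

theorem IsNormalizedEigensystem.isEigensystem (hvw : IsNormalizedEigensystem M v w) :
    IsEigensystem (M.map Complex.ofReal) (peripheralEigenvalue M h) v w :=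
  ⟨fun k => (hvw k).1, fun k => (hvw k).2.1, fun k => (hvw k).2.2⟩

theorem IsPeriod.norm_le_of_mem_spectrum_deflation (hM : ∀ i j, 0 ≤ M i j)
    (hPF : HasPerronFrobeniusProperty M) (hh : IsPeriod M h) (hvw : IsNormalizedEigensystem M v w)
    {z : ℂ}
    (hz : z ∈ spectrum ℂ (deflation (M.map Complex.ofReal) (peripheralEigenvalue M h) v w)) :
    ‖z‖ ≤ secondModulus M := by
  rcases eq_or_ne z 0 with rfl | hz0
  · rw [norm_zero]
    exact secondModulus_nonneg M
  obtain ⟨hzM, hzrange⟩ := hvw.isEigensystem.mem_spectrum_of_mem_spectrum_deflation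
    hh.injective_peripheralEigenvalue (hh.rootMultiplicity_peripheralEigenvalue hM hPF) hz hz0
  rw [hh.range_peripheralEigenvalue] at hzrange
  exact norm_le_secondModulus hzM
    ((norm_le_pfEigenvalue hzM).lt_of_ne fun hnorm => hzrange ⟨hzM, hnorm⟩)

theorem asymptoticFormula_eq_columnSum (M : Matrix m m ℝ) (j : m) (v w : Fin h → m → ℂ) (n : ℕ) :
    asymptoticFormula M j v w n =
      columnSum (∑ k, peripheralEigenvalue M h k ^ n • vecMulVec (v k) (w k)) j := by
  simp only [asymptoticFormula, columnSum, peripheralEigenvalue, Matrix.sum_apply,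
    Matrix.smul_apply, smul_eq_mul, mul_pow, Finset.sum_mul]
  rw [Finset.sum_comm]
  refine Finset.sum_congr rfl fun k _ => Finset.sum_congr rfl fun i _ => ?_
  ring

theorem IsPeriod.isBigO_columnSum_sub (hM : ∀ i j, 0 ≤ M i j)
    (hPF : HasPerronFrobeniusProperty M) (hh : IsPeriod M h) (hvw : IsNormalizedEigensystem M v w)
    (j : m) {ρ : ℝ} (hρ : secondModulus M < ρ) :
    (fun n => columnSum (M.map Complex.ofReal ^ n) j - asymptoticFormula M j v w n)
      =O[atTop] fun n => ρ ^ n := by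
  have hdeflation : (fun n => ∑ i, (deflation (M.map Complex.ofReal) (peripheralEigenvalue M h)
      v w ^ n) i j) =O[atTop] fun n => ρ ^ n :=
    IsBigO.fun_sum fun i _ => isBigO_pow_apply_of_spectrum_lt
      (fun z hz => (hh.norm_le_of_mem_spectrum_deflation hM hPF hvw hz).trans_lt hρ) i j
  refine hdeflation.congr' ?_ .rfl
  filter_upwards [eventually_ge_atTop 1] with n hn
  rw [← hvw.isEigensystem.pow_sub_sum hh.injective_peripheralEigenvalue hn,
    asymptoticFormula_eq_columnSum, columnSum, columnSum, ← Finset.sum_sub_distrib]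
  rfl

theorem isBigO_asymptoticFormula (M : Matrix m m ℝ) (j : m) (hh : h ≠ 0) (v w : Fin h → m → ℂ) :
    asymptoticFormula M j v w =O[atTop] fun n => pfEigenvalue M ^ n := by
  refine IsBigO.of_norm_le (g := fun n => (∑ k, ‖columnSum (vecMulVec (v k) (w k)) j‖) *
    pfEigenvalue M ^ n) (fun n => ?_) |>.trans (isBigO_const_mul_self _ _ _)
  rw [asymptoticFormula, norm_mul, norm_pow, norm_pfEigenvalue]
  gcongr
  · exact pow_nonneg (pfEigenvalue_nonneg M) n
  · refine norm_sum_le_of_le _ fun k _ => ?_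
    rw [norm_mul, norm_pow, norm_zeta_pow hh, one_pow, mul_one]

end SecondModulus

section PerronFrobeniusEigenvalue

variable {m : Type*} [Fintype m] [DecidableEq m] {M : Matrix m m ℝ}

theorem isBigO_pfEigenvalue_pow [Nonempty m] {g : ℕ → ℝ}
    (hg : ∀ i j, (fun n => (M ^ n) i j) =O[atTop] g) :
    (fun n => pfEigenvalue M ^ n) =O[atTop] g := by
  open scoped Matrix.Norms.Operator in
  have hnorm (n : ℕ) : ‖pfEigenvalue M ^ n‖ ≤ ∑ i, ∑ j, ‖(M ^ n) i j‖ := by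
    have hmap : M.map Complex.ofReal ^ n = (M ^ n).map Complex.ofReal :=
      (Matrix.map_pow (f := Complex.ofRealHom) M n).symm
    rw [norm_pow, Real.norm_of_nonneg (pfEigenvalue_nonneg M)]
    refine (spectralRadius_pow_le_norm_pow _ n).trans ?_
    have hsup : (Finset.univ.sup fun i => ∑ j, ‖(M ^ n) i j‖₊) ≤ ∑ i, ∑ j, ‖(M ^ n) i j‖₊ :=
      Finset.sup_le fun i _ => Finset.single_le_sum (f := fun i => ∑ j, ‖(M ^ n) i j‖₊)
        (fun _ _ => zero_le) (Finset.mem_univ i)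
    simpa only [hmap, linfty_opNorm_def, Matrix.map_apply, Complex.nnnorm_real, NNReal.coe_sum,
      coe_nnnorm] using NNReal.coe_le_coe.2 hsup
  exact (IsBigO.of_norm_le hnorm).trans
    (IsBigO.fun_sum fun i _ => IsBigO.fun_sum fun j _ => (hg i j).norm_left)

theorem HasPerronFrobeniusProperty.eq_zero (hPF : HasPerronFrobeniusProperty M)
    (hzero : pfEigenvalue M = 0) : M = 0 := by
  set A := M.map Complex.ofReal with hA
  have hroots : A.charpoly.roots = Multiset.replicate (Fintype.card m) 0 := by
    rw [← charpoly_natDegree_eq_dim A, ← IsAlgClosed.card_roots_eq_natDegree]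
    refine Multiset.eq_replicate_card.2 fun z hz => norm_le_zero_iff.1 ?_
    rw [← hzero]
    exact norm_le_pfEigenvalue (mem_spectrum_of_isRoot_charpoly (isRoot_of_mem_roots hz))
  have hcard : Fintype.card m = 1 := by
    have hmult := hPF.rootMultiplicity_map_ofReal
    rwa [hzero, Complex.ofReal_zero, ← count_roots, ← hA, hroots,
      Multiset.count_replicate_self] at hmult
  have htrace : (A ^ 1).trace = 0 := by
    rw [trace_pow_eq_sum_roots_charpoly, hroots, hcard]
    simp
  obtain ⟨i, hi⟩ := Fintype.card_eq_one_iff.1 hcard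
  have : Subsingleton m := ⟨fun k l => (hi k).trans (hi l).symm⟩
  rw [pow_one, Matrix.trace, Fintype.sum_subsingleton _ i] at htrace
  ext k l
  rw [hi k, hi l]
  exact Complex.ofReal_eq_zero.1 htrace

end PerronFrobeniusEigenvalue

section Limits

theorem convergesGeometrically_of_isBigO {f : ℕ → ℂ} {l : ℂ} {β : ℝ} (hβ : 0 ≤ β) (hβ' : β < 1)
    (hf : ∀ γ, β < γ → γ < 1 → (fun n => f n - l) =O[atTop] fun n => γ ^ n) :
    ConvergesGeometrically f l β := by
  refine ⟨hβ, hβ', fun γ hγ hγ' => ?_⟩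
  have hγ0 : 0 < γ := hβ.trans_lt hγ
  obtain ⟨B, hB⟩ := (isBigO_nat_atTop_iff fun n h => absurd h (pow_pos hγ0 n).ne').1 (hf γ hγ hγ')
  refine ⟨B, fun n => ?_⟩
  rw [norm_div, norm_pow, Complex.norm_real, ← norm_pow]
  exact (div_le_iff₀ (norm_pos_iff.2 (pow_pos hγ0 n).ne')).2 (hB n)

variable {a b : ℕ → ℂ} {r σ : ℝ}

theorem isBigO_ofReal_pow_inv (r : ℝ) :
    (fun n : ℕ => ((r : ℂ) ^ n)⁻¹) =O[atTop] fun n => (r ^ n)⁻¹ :=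
  .of_bound 1 <| .of_forall fun n => by
    rw [norm_inv, norm_inv, norm_pow, norm_pow, Complex.norm_real, one_mul]

theorem convergesGeometrically_sub_div_pow (hσ : 0 ≤ σ) (hσr : σ < r)
    (hab : ∀ ρ, σ < ρ → (fun n => b n - a n) =O[atTop] fun n => ρ ^ n) :
    ConvergesGeometrically (fun n => (b n - a n) / (r : ℂ) ^ n) 0 (σ / r) := by
  have hr : 0 < r := hσ.trans_lt hσr
  refine convergesGeometrically_of_isBigO (div_nonneg hσ hr.le) ((div_lt_one hr).2 hσr)
    fun γ hγ _ => ?_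
  refine ((hab (γ * r) ((div_lt_iff₀ hr).1 hγ)).mul (isBigO_ofReal_pow_inv r)).congr (fun n => ?_)
    fun n => ?_
  · rw [sub_zero, div_eq_mul_inv]
  · rw [mul_pow, mul_inv_cancel_right₀ (pow_pos hr n).ne']

theorem isEquivalent_of_isBigO_sub (hσ : 0 ≤ σ) (hσr : σ < r)
    (hab : ∀ ρ, σ < ρ → (fun n => b n - a n) =O[atTop] fun n => ρ ^ n)
    (hb : (fun n => r ^ n) =O[atTop] b) : b ~[atTop] a := by
  obtain ⟨ρ, hσρ, hρr⟩ := exists_between hσr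
  have hlittle : (fun n => b n - a n) =o[atTop] b :=
    ((hab ρ hσρ).trans_isLittleO (isLittleO_pow_pow_of_lt_left (hσ.trans hσρ.le) hρr)).trans_isBigO
      hb
  exact IsEquivalent.symm (hlittle.neg_left.congr_left fun n => neg_sub (b n) (a n))

theorem convergesGeometrically_div (hσ : 0 ≤ σ) (hσr : σ < r)
    (hab : ∀ ρ, σ < ρ → (fun n => b n - a n) =O[atTop] fun n => ρ ^ n)
    (hb : (fun n => r ^ n) =O[atTop] b) :
    ConvergesGeometrically (fun n => b n / a n) 1 (σ / r) := by
  have hr : 0 < r := hσ.trans_lt hσr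
  have ha : (fun n => r ^ n) =O[atTop] a :=
    hb.trans (isEquivalent_of_isBigO_sub hσ hσr hab hb).isBigO
  have hr0 (n : ℕ) : r ^ n ≠ 0 := (pow_pos hr n).ne'
  have ha0 : ∀ᶠ n in atTop, a n ≠ 0 := ha.eq_zero_imp.mono fun n hn han => hr0 n (hn han)
  refine convergesGeometrically_of_isBigO (div_nonneg hσ hr.le) ((div_lt_one hr).2 hσr)
    fun γ hγ _ => ?_
  have hinv := ha.inv_rev (.of_forall fun n hn => absurd hn (hr0 n))
  refine ((hab (γ * r) ((div_lt_iff₀ hr).1 hγ)).mul hinv).congr' ?_ (.of_forall fun n => ?_)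
  · filter_upwards [ha0] with n hn
    rw [div_sub_one hn, div_eq_mul_inv]
  · exact (congrArg (· * _) (mul_pow γ r n)).trans (mul_inv_cancel_right₀ (hr0 n) _)

theorem tendsto_const_mul_pow_rpow_one_div {c r : ℝ} (hc : 0 < c) (hr : 0 ≤ r) :
    Tendsto (fun n : ℕ => (c * r ^ n) ^ (1 / (n : ℝ))) atTop (𝓝 r) := by
  have hlim : Tendsto (fun n : ℕ => c ^ (1 / (n : ℝ)) * r) atTop (𝓝 (c ^ (0 : ℝ) * r)) :=
    ((Real.continuousAt_const_rpow hc.ne').tendsto.comp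
      tendsto_one_div_atTop_nhds_zero_nat).mul_const r
  rw [Real.rpow_zero, one_mul] at hlim
  refine hlim.congr' ?_
  filter_upwards [eventually_ne_atTop 0] with n hn
  rw [Real.mul_rpow hc.le (pow_nonneg hr n), one_div, Real.pow_rpow_inv_natCast hr hn]

theorem tendsto_rpow_one_div_of_isTheta {b : ℕ → ℝ} {r : ℝ} (hr : 0 ≤ r) (hb : ∀ n, 0 ≤ b n)
    (hbr : b =Θ[atTop] fun n => r ^ n) :
    Tendsto (fun n : ℕ => b n ^ (1 / (n : ℝ))) atTop (𝓝 r) := by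
  obtain ⟨C, hC, hupper⟩ := hbr.1.exists_pos
  obtain ⟨c, hc, hlower⟩ := hbr.2.exists_pos
  refine tendsto_of_tendsto_of_tendsto_of_le_of_le'
    (tendsto_const_mul_pow_rpow_one_div (inv_pos.2 hc) hr)
    (tendsto_const_mul_pow_rpow_one_div hC hr) ?_ ?_
  · filter_upwards [hlower.bound] with n hn
    rw [Real.norm_of_nonneg (pow_nonneg hr n), Real.norm_of_nonneg (hb n)] at hn
    gcongr
    rwa [inv_mul_le_iff₀ hc]
  · filter_upwards [hupper.bound] with n hn
    rw [Real.norm_of_nonneg (pow_nonneg hr n), Real.norm_of_nonneg (hb n)] at hn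
    gcongr
    exact hb n

end Limits

namespace FiniteBasedAlgebra

variable {K : Subring ℂ} {R : Type*} [Ring R] [Algebra K R] {ι : Type*} [Fintype ι]
  (C : FiniteBasedAlgebra K R ι)

section Multiplication

theorem structureConst_nonneg (i j k : ι) : 0 ≤ C.structureConst i j k :=
  (Complex.nonneg_iff.1 (C.structure_nonneg i j k)).1

theorem ofReal_structureConst (i j k : ι) :
    (C.structureConst i j k : ℂ) = ((C.basis.repr (C.basis i * C.basis j) k : K) : ℂ) :=
  Complex.ext rfl (Complex.nonneg_iff.1 (C.structure_nonneg i j k)).2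

theorem baseChange_one : C.basis.baseChange ℂ C.one = 1 := by
  rw [Module.Basis.baseChange_apply, C.basis_one, Algebra.TensorProduct.one_def]

theorem repr_basis_mul_basis (i j k : ι) :
    (C.basis.baseChange ℂ).repr (C.basis.baseChange ℂ i * C.basis.baseChange ℂ j) k =
      C.structureConst i j k := by
  rw [Module.Basis.baseChange_apply, Module.Basis.baseChange_apply,
    Algebra.TensorProduct.tmul_mul_tmul, one_mul, Module.Basis.baseChange_repr_tmul,
    ofReal_structureConst, Subring.smul_def, smul_eq_mul, mul_one]

theorem repr_mul_basis (y : ℂ ⊗[K] R) (j k : ι) :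
    (C.basis.baseChange ℂ).repr (y * C.basis.baseChange ℂ j) k =
      ∑ i, (C.structureConst i j k : ℂ) * (C.basis.baseChange ℂ).repr y i := by
  conv_lhs => rw [← (C.basis.baseChange ℂ).sum_repr y]
  simp only [Finset.sum_mul, smul_mul_assoc, map_sum, map_smul, Finsupp.finsetSum_apply,
    Finsupp.smul_apply, repr_basis_mul_basis, smul_eq_mul, mul_comm]

theorem repr_mul (y z : ℂ ⊗[K] R) (k : ι) :
    (C.basis.baseChange ℂ).repr (y * z) k =
      ∑ j, (∑ i, (C.structureConst i j k : ℂ) * (C.basis.baseChange ℂ).repr y i) *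
        (C.basis.baseChange ℂ).repr z j := by
  conv_lhs => rw [← (C.basis.baseChange ℂ).sum_repr z]
  simp only [Finset.mul_sum, mul_smul_comm, map_sum, map_smul, Finsupp.finsetSum_apply,
    Finsupp.smul_apply, repr_mul_basis, smul_eq_mul, mul_comm]

theorem repr_element (x : ι → ℝ) (i : ι) : (C.basis.baseChange ℂ).repr (C.element x) i = x i := by
  classical
  simp only [element, map_sum, Finsupp.finsetSum_apply, Module.Basis.baseChange_repr_tmul,
    Module.Basis.repr_self, Finsupp.single_apply, ite_smul, one_smul, zero_smul,
    Finset.sum_ite_eq', Finset.mem_univ, if_true]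

theorem repr_element_mul (x : ι → ℝ) (y : ℂ ⊗[K] R) (k : ι) :
    (C.basis.baseChange ℂ).repr (C.element x * y) k =
      ∑ j, (C.preActionMatrix x k j : ℂ) * (C.basis.baseChange ℂ).repr y j := by
  simp only [repr_mul, repr_element, preActionMatrix, of_apply, Complex.ofReal_sum,
    Complex.ofReal_mul, mul_comm]

theorem preActionMatrix_apply_one (x : ι → ℝ) (k : ι) : C.preActionMatrix x k C.one = x k := by
  have h := C.repr_mul_basis (C.element x) C.one k
  simp only [baseChange_one, mul_one, repr_element] at h
  rw [preActionMatrix, of_apply]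
  exact_mod_cast (h.trans (Finset.sum_congr rfl fun i _ => mul_comm _ _)).symm

theorem preActionMatrix_nonneg {x : ι → ℝ} (hx : ∀ i, 0 ≤ x i) (k j : ι) :
    0 ≤ C.preActionMatrix x k j :=
  Finset.sum_nonneg fun i _ => mul_nonneg (hx i) (C.structureConst_nonneg i j k)

theorem actionMatrix_apply (x : ι → ℝ) (k j : C.component x) :
    C.actionMatrix x k j = C.preActionMatrix x k j :=
  rfl

theorem actionMatrix_nonneg {x : ι → ℝ} (hx : ∀ i, 0 ≤ x i) (k j : C.component x) :
    0 ≤ C.actionMatrix x k j :=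
  C.preActionMatrix_nonneg hx k j

end Multiplication

section Component

variable {C} {x : ι → ℝ}

theorem mem_component_of_preActionMatrix_ne_zero {k j : ι} (hj : j ∈ C.component x)
    (hkj : C.preActionMatrix x k j ≠ 0) : k ∈ C.component x := by
  simp only [component, Finset.mem_filter_univ] at hj ⊢
  exact hj.trans _ _ _ ((Relation.EqvGen.rel k j hkj).symm _ _)

theorem eq_zero_of_actionMatrix_eq_zero (hzero : C.actionMatrix x = 0) : x = 0 := by
  ext k
  by_contra hk
  rw [Pi.zero_apply, ← C.preActionMatrix_apply_one x] at hk
  have hmem := mem_component_of_preActionMatrix_ne_zero (C.oneVertex x).2 hk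
  exact hk (congrFun₂ hzero ⟨k, hmem⟩ (C.oneVertex x))

variable [DecidableEq ι]

theorem preActionMatrix_pow_apply_eq_zero {k j : ι} (hj : j ∈ C.component x)
    (hk : k ∉ C.component x) (n : ℕ) : (C.preActionMatrix x ^ n) k j = 0 := by
  induction n generalizing k with
  | zero => rw [pow_zero, one_apply_ne (ne_of_mem_of_not_mem hj hk).symm]
  | succ n ih =>
    rw [pow_succ', mul_apply]
    refine Finset.sum_eq_zero fun l _ => ?_
    by_cases hl : l ∈ C.component x
    · rw [not_imp_comm.1 (mem_component_of_preActionMatrix_ne_zero hl) hk, zero_mul]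
    · rw [ih hl, mul_zero]

theorem actionMatrix_pow_apply (n : ℕ) (k j : C.component x) :
    (C.actionMatrix x ^ n) k j = (C.preActionMatrix x ^ n) k j := by
  induction n generalizing k with
  | zero => simp only [pow_zero, one_apply, Subtype.ext_iff]
  | succ n ih =>
    have hoff (l : ι) (hl : l ∉ C.component x) :
        C.preActionMatrix x k l * (C.preActionMatrix x ^ n) l j = 0 := by
      rw [preActionMatrix_pow_apply_eq_zero j.2 hl, mul_zero]
    simp only [pow_succ', mul_apply, ih, actionMatrix_apply]
    rw [Finset.sum_coe_sort _ fun l => C.preActionMatrix x k l * (C.preActionMatrix x ^ n) l j]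
    exact Finset.sum_subset (Finset.subset_univ _) fun l _ hl => hoff l hl

end Component

section Growth

variable [DecidableEq ι]

theorem repr_pow_mul_basis (x : ι → ℝ) (n : ℕ) (j k : ι) :
    (C.basis.baseChange ℂ).repr (C.element x ^ n * C.basis.baseChange ℂ j) k =
      ((C.preActionMatrix x ^ n) k j : ℝ) := by
  induction n generalizing k with
  | zero =>
    rw [pow_zero, one_mul, Module.Basis.repr_self, pow_zero, Finsupp.single_apply, one_apply]
    simp only [eq_comm (a := k), apply_ite Complex.ofReal, Complex.ofReal_one, Complex.ofReal_zero]
  | succ n ih =>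
    rw [pow_succ', mul_assoc, repr_element_mul, pow_succ', mul_apply]
    simp only [ih, Complex.ofReal_sum, Complex.ofReal_mul]

theorem repr_pow (x : ι → ℝ) (n : ℕ) (k : ι) :
    (C.basis.baseChange ℂ).repr (C.element x ^ n) k =
      ((C.preActionMatrix x ^ n) k C.one : ℝ) := by
  rw [← repr_pow_mul_basis, baseChange_one, mul_one]

theorem growth_eq_sum_preActionMatrix_pow (x : ι → ℝ) (n : ℕ) :
    C.growth x n = ∑ k, (C.preActionMatrix x ^ n) k C.one := by
  simp only [growth, repr_pow, Complex.ofReal_re]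

theorem growth_eq_sum_actionMatrix_pow (x : ι → ℝ) (n : ℕ) :
    C.growth x n = ∑ k, (C.actionMatrix x ^ n) k (C.oneVertex x) := by
  have hoff (k : ι) (hk : k ∉ C.component x) : (C.preActionMatrix x ^ n) k C.one = 0 :=
    preActionMatrix_pow_apply_eq_zero (C.oneVertex x).2 hk n
  simp only [growth_eq_sum_preActionMatrix_pow, actionMatrix_pow_apply, oneVertex]
  rw [Finset.sum_coe_sort _ fun k => (C.preActionMatrix x ^ n) k C.one]
  exact (Finset.sum_subset (Finset.subset_univ _) fun k _ hk => hoff k hk).symm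

theorem ofReal_growth_eq_columnSum (x : ι → ℝ) (n : ℕ) :
    (C.growth x n : ℂ) = columnSum ((C.actionMatrix x).map Complex.ofReal ^ n) (C.oneVertex x) := by
  rw [growth_eq_sum_actionMatrix_pow, Complex.ofReal_sum, columnSum]
  exact Finset.sum_congr rfl fun k _ =>
    congrFun₂ (Matrix.map_pow (f := Complex.ofRealHom) (C.actionMatrix x) n) k (C.oneVertex x)

theorem preActionMatrix_pow_apply (x : ι → ℝ) (n : ℕ) (k j : ι) :
    (C.preActionMatrix x ^ n) k j =
      ∑ i, C.structureConst i j k * (C.preActionMatrix x ^ n) i C.one := by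
  have h := C.repr_mul_basis (C.element x ^ n) j k
  simp only [repr_pow_mul_basis, repr_pow] at h
  exact_mod_cast h

variable {x : ι → ℝ} (hx : ∀ i, 0 ≤ x i)
include hx

theorem preActionMatrix_pow_nonneg (n : ℕ) (k j : ι) : 0 ≤ (C.preActionMatrix x ^ n) k j :=
  Matrix.pow_apply_nonneg (C.preActionMatrix_nonneg hx) n k j

omit [DecidableEq ι] in
theorem growth_nonneg (n : ℕ) : 0 ≤ C.growth x n := by
  classical
  rw [growth_eq_sum_preActionMatrix_pow]
  exact Finset.sum_nonneg fun k _ => C.preActionMatrix_pow_nonneg hx n k C.one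

theorem isBigO_preActionMatrix_pow_growth (k j : ι) :
    (fun n => (C.preActionMatrix x ^ n) k j) =O[atTop] C.growth x := by
  have hcoeff (i : ι) : (fun n => (C.preActionMatrix x ^ n) i C.one) =O[atTop] C.growth x := by
    refine IsBigO.of_norm_le fun n => ?_
    rw [Real.norm_of_nonneg (C.preActionMatrix_pow_nonneg hx n i C.one),
      growth_eq_sum_preActionMatrix_pow]
    exact Finset.single_le_sum (f := fun i => (C.preActionMatrix x ^ n) i C.one)
      (fun i _ => C.preActionMatrix_pow_nonneg hx n i C.one) (Finset.mem_univ i)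
  simp only [C.preActionMatrix_pow_apply x _ k j]
  exact IsBigO.fun_sum fun i _ => (hcoeff i).const_mul_left _

theorem isBigO_pfEigenvalue_pow_growth :
    (fun n => pfEigenvalue (C.actionMatrix x) ^ n) =O[atTop] C.growth x := by
  have : Nonempty (C.component x) := ⟨C.oneVertex x⟩
  refine isBigO_pfEigenvalue_pow fun k j => ?_
  simp only [actionMatrix_pow_apply]
  exact C.isBigO_preActionMatrix_pow_growth hx k j

end Growth

section Asymptotics

variable {C} [DecidableEq ι] {x : ι → ℝ} {h : ℕ} {v w : Fin h → C.component x → ℂ}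

theorem growth_eq_zero_of_pfEigenvalue_eq_zero
    (hPF : HasPerronFrobeniusProperty (C.actionMatrix x))
    (hzero : pfEigenvalue (C.actionMatrix x) = 0) {n : ℕ} (hn : n ≠ 0) : C.growth x n = 0 := by
  simp only [growth_eq_sum_actionMatrix_pow, hPF.eq_zero hzero, zero_pow hn, Matrix.zero_apply,
    Finset.sum_const_zero]

theorem pfEigenvalue_pos (hPF : HasPerronFrobeniusProperty (C.actionMatrix x)) (hx : x ≠ 0) :
    0 < pfEigenvalue (C.actionMatrix x) :=
  (pfEigenvalue_nonneg _).lt_of_ne' fun hzero =>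
    hx (eq_zero_of_actionMatrix_eq_zero (hPF.eq_zero hzero))

variable (hx : ∀ i, 0 ≤ x i) (hPF : HasPerronFrobeniusProperty (C.actionMatrix x))
  (hh : IsPeriod (C.actionMatrix x) h) (hvw : IsNormalizedEigensystem (C.actionMatrix x) v w)
include hx hPF hh hvw

theorem isBigO_growth_sub_asymptoticFormula {ρ : ℝ} (hρ : secondModulus (C.actionMatrix x) < ρ) :
    (fun n => (C.growth x n : ℂ) -
      asymptoticFormula (C.actionMatrix x) (C.oneVertex x) v w n) =O[atTop] fun n => ρ ^ n := by
  simp only [ofReal_growth_eq_columnSum]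
  exact hh.isBigO_columnSum_sub (C.actionMatrix_nonneg hx) hPF hvw (C.oneVertex x) hρ

theorem isEquivalent_growth_asymptoticFormula :
    (fun n => (C.growth x n : ℂ)) ~[atTop]
      asymptoticFormula (C.actionMatrix x) (C.oneVertex x) v w := by
  rcases (pfEigenvalue_nonneg (C.actionMatrix x)).eq_or_lt' with hzero | hpos
  · refine EventuallyEq.isEquivalent ?_
    filter_upwards [eventually_ne_atTop 0] with n hn
    rw [growth_eq_zero_of_pfEigenvalue_eq_zero hPF hzero hn, asymptoticFormula, hzero,
      Complex.ofReal_zero, zero_pow hn, mul_zero]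
  · exact isEquivalent_of_isBigO_sub (secondModulus_nonneg _) (secondModulus_lt_pfEigenvalue hpos)
      (fun ρ hρ => isBigO_growth_sub_asymptoticFormula hx hPF hh hvw hρ)
      (Complex.isBigO_ofReal_right.2 (C.isBigO_pfEigenvalue_pow_growth hx))

theorem convergesGeometrically_growth_div_asymptoticFormula (hne : x ≠ 0) :
    ConvergesGeometrically
      (fun n => (C.growth x n : ℂ) /
        asymptoticFormula (C.actionMatrix x) (C.oneVertex x) v w n) 1
      (secondModulus (C.actionMatrix x) / pfEigenvalue (C.actionMatrix x)) :=
  convergesGeometrically_div (secondModulus_nonneg _)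
    (secondModulus_lt_pfEigenvalue (pfEigenvalue_pos hPF hne))
    (fun _ hρ => isBigO_growth_sub_asymptoticFormula hx hPF hh hvw hρ)
    (Complex.isBigO_ofReal_right.2 (C.isBigO_pfEigenvalue_pow_growth hx))

theorem convergesGeometrically_growth_sub_asymptoticFormula_div :
    ConvergesGeometrically
      (fun n => ((C.growth x n : ℂ) -
        asymptoticFormula (C.actionMatrix x) (C.oneVertex x) v w n) /
          (pfEigenvalue (C.actionMatrix x) : ℂ) ^ n) 0
      (secondModulus (C.actionMatrix x) / pfEigenvalue (C.actionMatrix x)) := by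
  rcases (pfEigenvalue_nonneg (C.actionMatrix x)).eq_or_lt' with hzero | hpos
  · rw [hzero, div_zero]
    refine convergesGeometrically_of_isBigO le_rfl one_pos fun γ _ _ => ?_
    refine (isBigO_zero _ _).congr' ?_ .rfl
    filter_upwards [eventually_ne_atTop 0] with n hn
    rw [Complex.ofReal_zero, zero_pow hn, div_zero, sub_zero]
  · exact convergesGeometrically_sub_div_pow (secondModulus_nonneg _)
      (secondModulus_lt_pfEigenvalue hpos)
      fun ρ hρ => isBigO_growth_sub_asymptoticFormula hx hPF hh hvw hρ

theorem isTheta_growth_pfEigenvalue_pow :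
    C.growth x =Θ[atTop] fun n => pfEigenvalue (C.actionMatrix x) ^ n :=
  ⟨Complex.isBigO_ofReal_left.1 <|
    (isEquivalent_growth_asymptoticFormula hx hPF hh hvw).isBigO.trans
      (isBigO_asymptoticFormula _ _ (Nat.one_le_iff_ne_zero.1 hh.1) v w),
    C.isBigO_pfEigenvalue_pow_growth hx⟩

theorem tendsto_growth_rpow_one_div :
    Tendsto (fun n : ℕ => C.growth x n ^ (1 / (n : ℝ))) atTop
      (𝓝 (pfEigenvalue (C.actionMatrix x))) :=
  tendsto_rpow_one_div_of_isTheta (pfEigenvalue_nonneg _) (C.growth_nonneg hx)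
    (isTheta_growth_pfEigenvalue_pow hx hPF hh hvw)

end Asymptotics

end FiniteBasedAlgebra

end BasedAlgebra

open BasedAlgebra in
theorem mainTheorem5 {K : Subring ℂ} {R : Type*} [Ring R] [Algebra K R]
    {ι : Type*} [Fintype ι] [DecidableEq ι] (C : FiniteBasedAlgebra K R ι)
    (x : ι → ℝ) (hx : ∀ i, 0 ≤ x i)
    (hPF : HasPerronFrobeniusProperty (C.actionMatrix x)) :
    (∃ h : ℕ, IsPeriod (C.actionMatrix x) h ∧
      (∃ v w : Fin h → C.component x → ℂ, IsNormalizedEigensystem (C.actionMatrix x) v w) ∧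
      ∀ v w : Fin h → C.component x → ℂ, IsNormalizedEigensystem (C.actionMatrix x) v w →
        Asymptotics.IsEquivalent Filter.atTop (fun n : ℕ => (C.growth x n : ℂ))
          (asymptoticFormula (C.actionMatrix x) (C.oneVertex x) v w) ∧
        (x ≠ 0 → ConvergesGeometrically
          (fun n : ℕ => (C.growth x n : ℂ) /
            asymptoticFormula (C.actionMatrix x) (C.oneVertex x) v w n) 1
          (secondModulus (C.actionMatrix x) / pfEigenvalue (C.actionMatrix x))) ∧
        ConvergesGeometrically
          (fun n : ℕ => ((C.growth x n : ℂ) -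
            asymptoticFormula (C.actionMatrix x) (C.oneVertex x) v w n) /
              (pfEigenvalue (C.actionMatrix x) : ℂ) ^ n) 0
          (secondModulus (C.actionMatrix x) / pfEigenvalue (C.actionMatrix x))) ∧
    Filter.Tendsto (fun n : ℕ => C.growth x n ^ (1 / (n : ℝ))) Filter.atTop
      (nhds (pfEigenvalue (C.actionMatrix x))) := by
  have hM := C.actionMatrix_nonneg hx
  obtain ⟨h, hh⟩ := exists_isPeriod hM hPF
  obtain ⟨v₀, w₀, hvw₀⟩ := hh.exists_isNormalizedEigensystem hM hPF
  exact ⟨⟨h, hh, ⟨v₀, w₀, hvw₀⟩, fun v w hvw =>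
    ⟨FiniteBasedAlgebra.isEquivalent_growth_asymptoticFormula hx hPF hh hvw,
      FiniteBasedAlgebra.convergesGeometrically_growth_div_asymptoticFormula hx hPF hh hvw,
      FiniteBasedAlgebra.convergesGeometrically_growth_sub_asymptoticFormula_div hx hPF hh hvw⟩⟩,
    FiniteBasedAlgebra.tendsto_growth_rpow_one_div hx hPF hh hvw₀⟩
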